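/- Let $\mathbb F$ be a field. For an $m\times n$ pencil $A+\lambda B$ over $\mathbb F$, the minimal ranks $\rho(A,B)=(r,s)$ are $$s=\min_{(t,u)\ne 0}\operatorname{rank}(tA+uB),\qquad r=\min_{(t',u')\notin\operatorname{span}\{(t^\star,u^\star)\}}\operatorname{rank}(t'A+u'B),$$ where $(t^\star,u^\star)\in\mathbb F^2\setminus\{0\}$ is any minimizer in the definition of $s$ (the value of $r$ does not depend on its choice). Let $H_v$ be the $v\times v$ matrix with ones on the superdiagonal and zeros elsewhere, $E$ the identity matrix, $J_d(a)=aE+H_d$, and $N_v(\lambda)=E+\lambda H_v$. Let $L_k(\lambda)$ be the $k\times(k+1)$ pencil with entries $\lambda$ at the positions $(i,i)$, entries $1$ at the positions $(i,i+1)$ and zeros elsewhere, and let $R_l(\lambda)=L_l(\lambda)^{\mathsf T}$. Let $A+\lambda B$ be an arbitrary $m\times n$ pencil over $\mathbb F$ with Kronecker canonical form $S(\lambda)\oplus(A'+\lambda B')$; that is, for some invertible $P,U$ over $\mathbb F$, $P(A+\lambda B)U^{\mathsf T}=S(\lambda)\oplus(A'+\lambda B')$, where the singular part is $$S(\lambda)=L_{k_1}(\lambda)\oplus\dots\oplus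 L_{k_p}(\lambda)\oplus R_{l_1}(\lambda)\oplus\dots\oplus R_{l_{p'}}(\lambda)$$ with minimal column indices $k_1,\dots,k_p\ge 0$ and minimal row indices $l_1,\dots,l_{p'}\ge 0$, and the regular part, of size $n'\times n'$, is $$A'+\lambda B'=\big[N_{v_1}(\lambda)\oplus\dots\oplus N_{v_j}(\lambda)\big]\oplus\big[(J_{d_1}(a_1)\oplus\dots\oplus J_{d_k}(a_k)\oplus Q)+\lambda E\big]$$ with $v_i,d_i\ge 1$, $a_i\in\mathbb F$, and $Q$ a square matrix over $\mathbb F$ such that no elementary divisor of $Q+\lambda E$ over $\mathbb F$ is a power of a linear form. (Any of these groups of blocks may be empty.) Put $\bar s=k_1+\dots+k_p+l_1+\dots+l_{p'}$. For $a\in\mathbb F$ let $c(a)$ be the number of indices $i$ with $a_i=a$. Let $k_s=c(a^\star)$ be the largest value of $c$ on $\mathbb F$, and let $k_r=c(a^{\star\star})$ be the largest value of $c$ on $\mathbb F\setminus\{a^\star\}$. Let $k'_s\ge k'_r$ be the first and second largest components (with multiplicity) of the triple $(j,k_s,k_r)$. Then $$\rho(A',B')=(n'-k'_r,\;n'-k'_s)\qquad\text{and}\qquad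 \rho(A,B)=\rho(A',B')+(\bar s,\bar s).$$ -/

import Mathlib

open Matrix Polynomial

/-- A matrix pencil `A + λ B` over `F`, given by its coefficients `A = const` and `B = lin`. -/
structure MatrixPencil (F m n : Type*) where
  const : Matrix m n F
  lin : Matrix m n F

namespace MatrixPencil

/-- The linear combination `t A + u B`, with `x = (t, u)`. -/
def comb {F m n : Type*} [Field F] (L : MatrixPencil F m n) (x : F × F) : Matrix m n F :=
  x.1 • L.const + x.2 • L.lin

/-- `x` attains the minimum of `rank (t A + u B)` over all `(t, u) ≠ 0`. -/
def IsMinimizer {F m n : Type*} [Field F] [Fintype n]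
    (L : MatrixPencil F m n) (x : F × F) : Prop :=
  x ≠ 0 ∧ ∀ y : F × F, y ≠ 0 → (L.comb x).rank ≤ (L.comb y).rank

/-- `ρ(L) = (r, s)`: the number `s` is the minimum of `rank (t A + u B)` over `(t, u) ≠ 0` and,
whichever minimizer `x` is picked, `r` is the minimum of `rank (t' A + u' B)` over all `(t', u')`
outside the line spanned by `x`. -/
def HasMinRanks {F m n : Type*} [Field F] [Fintype n]
    (L : MatrixPencil F m n) (r s : ℕ) : Prop :=
  IsLeast {k : ℕ | ∃ x : F × F, x ≠ 0 ∧ (L.comb x).rank = k} s ∧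
  ∀ x : F × F, L.IsMinimizer x →
    IsLeast {k : ℕ | ∃ y : F × F, y ∉ Submodule.span F {x} ∧ (L.comb y).rank = k} r

/-- The minimal ranks of a pencil are unique. -/
theorem HasMinRanks.unique {F m n : Type*} [Field F] [Fintype n] {L : MatrixPencil F m n}
    {r s r' s' : ℕ} (h : L.HasMinRanks r s) (h' : L.HasMinRanks r' s') : r = r' ∧ s = s' := by
  obtain ⟨x, hx, hxs⟩ := h.1.1
  have hm : L.IsMinimizer x := ⟨hx, fun y hy => hxs ▸ h.1.2 ⟨y, hy, rfl⟩⟩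
  exact ⟨(h.2 x hm).unique (h'.2 x hm), h.1.unique h'.1⟩

/-- The transposed pencil. -/
def transpose {F m n : Type*} (L : MatrixPencil F m n) : MatrixPencil F n m :=
  ⟨L.constᵀ, L.linᵀ⟩

/-- The direct sum `L ⊕ M` (block diagonal). -/
def directSum {F m n m' n' : Type*} [Field F]
    (L : MatrixPencil F m n) (M : MatrixPencil F m' n') : MatrixPencil F (m ⊕ m') (n ⊕ n') :=
  ⟨Matrix.fromBlocks L.const 0 0 M.const, Matrix.fromBlocks L.lin 0 0 M.lin⟩

/-- The direct sum of a finite family of pencils (block diagonal). -/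
def blockSum {F : Type*} [Field F] {p : ℕ} {m n : Fin p → Type*}
    (L : ∀ i, MatrixPencil F (m i) (n i)) : MatrixPencil F (Σ i, m i) (Σ i, n i) :=
  ⟨Matrix.blockDiagonal' fun i => (L i).const, Matrix.blockDiagonal' fun i => (L i).lin⟩

/-- The matrix `H_v`, with ones on the superdiagonal and zeros elsewhere. -/
def shift (F : Type*) [Field F] (v : ℕ) : Matrix (Fin v) (Fin v) F :=
  Matrix.of fun i j => if (j : ℕ) = (i : ℕ) + 1 then 1 else 0

/-- `L_k(λ)`, the `k × (k+1)` pencil with `λ` at `(i, i)` and `1` at `(i, i + 1)`. -/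
def colBlock (F : Type*) [Field F] (k : ℕ) : MatrixPencil F (Fin k) (Fin (k + 1)) :=
  ⟨Matrix.of fun i j => if (j : ℕ) = (i : ℕ) + 1 then 1 else 0,
   Matrix.of fun i j => if (j : ℕ) = (i : ℕ) then 1 else 0⟩

/-- `R_l(λ)`, the `(l+1) × l` transpose of `L_l(λ)`. -/
def rowBlock (F : Type*) [Field F] (l : ℕ) : MatrixPencil F (Fin (l + 1)) (Fin l) :=
  (colBlock F l).transpose

/-- `N_v(λ) = E + λ H_v`, the block of an infinite elementary divisor. -/
def infBlock (F : Type*) [Field F] (v : ℕ) : MatrixPencil F (Fin v) (Fin v) :=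
  ⟨1, shift F v⟩

/-- `J_d(a) + λ E` with `J_d(a) = a E + H_d`, the block of the elementary divisor `(a + λ)^d`. -/
def jordanBlock {F : Type*} [Field F] (d : ℕ) (a : F) : MatrixPencil F (Fin d) (Fin d) :=
  ⟨a • (1 : Matrix (Fin d) (Fin d) F) + shift F d, 1⟩

/-- The pencil `A + λ B` as a matrix of polynomials in `λ`. -/
noncomputable def toPolyMatrix {F m n : Type*} [Field F] (L : MatrixPencil F m n) :
    Matrix m n F[X] :=
  L.const.map C + (X : F[X]) • L.lin.map C

end MatrixPencil

/-- `f` is an elementary divisor of the square polynomial matrix `M`: it is a positive power of a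
monic irreducible polynomial, and the cyclic module `F[λ] / (f)` is a direct summand of the
cokernel of `M`. -/
def IsElementaryDivisor {F : Type*} [Field F] {q : ℕ} (M : Matrix (Fin q) (Fin q) F[X])
    (f : F[X]) : Prop :=
  (∃ (g : F[X]) (e : ℕ), g.Monic ∧ Irreducible g ∧ 0 < e ∧ f = g ^ e) ∧
  ∃ N N' : Submodule F[X] ((Fin q → F[X]) ⧸ LinearMap.range M.mulVecLin),
    IsCompl N N' ∧ Nonempty (N ≃ₗ[F[X]] (F[X] ⧸ Ideal.span {f}))

/-- A Kronecker canonical form over `F`: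
`[⨁ L_{k_i}] ⊕ [⨁ R_{l_i}] ⊕ ([⨁ N_{v_i}] ⊕ [⨁ (J_{d_i}(a_i) + λ E)] ⊕ [Q + λ E])`,
where no elementary divisor of `Q + λ E` is a power of a linear form. -/
structure KroneckerForm (F : Type*) [Field F] where
  /-- number of minimal column indices -/
  numCol : ℕ
  /-- minimal column indices -/
  k : Fin numCol → ℕ
  /-- number of minimal row indices -/
  numRow : ℕ
  /-- minimal row indices -/
  l : Fin numRow → ℕ
  /-- number of blocks with an infinite elementary divisor -/
  j : ℕ
  /-- sizes of these blocks -/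
  v : Fin j → ℕ
  v_pos : ∀ i, 0 < v i
  /-- number of Jordan blocks -/
  numJordan : ℕ
  /-- sizes of the Jordan blocks -/
  d : Fin numJordan → ℕ
  d_pos : ∀ i, 0 < d i
  /-- the elementary divisor of the `i`-th Jordan block is `(a i + λ) ^ (d i)` -/
  a : Fin numJordan → F
  /-- size of `Q` -/
  q : ℕ
  Q : Matrix (Fin q) (Fin q) F
  Q_nonlinear : ∀ f : F[X], IsElementaryDivisor (MatrixPencil.mk Q 1).toPolyMatrix f →
    ¬ ∃ (b : F) (e : ℕ), f = (C b + X) ^ e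

namespace KroneckerForm

variable {F : Type*} [Field F] (K : KroneckerForm F)

/-- Row indices of the singular part. -/
abbrev SingRow : Type := (Σ i, Fin (K.k i)) ⊕ (Σ i, Fin (K.l i + 1))

/-- Column indices of the singular part. -/
abbrev SingCol : Type := (Σ i, Fin (K.k i + 1)) ⊕ (Σ i, Fin (K.l i))

/-- Row and column indices of the regular part. -/
abbrev Reg : Type := (Σ i, Fin (K.v i)) ⊕ ((Σ i, Fin (K.d i)) ⊕ Fin K.q)

/-- The singular part `S(λ)`. -/
def singularPart : MatrixPencil F K.SingRow K.SingCol :=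
  (MatrixPencil.blockSum fun i => MatrixPencil.colBlock F (K.k i)).directSum
    (MatrixPencil.blockSum fun i => MatrixPencil.rowBlock F (K.l i))

/-- The regular part `A' + λ B'`. -/
def regularPart : MatrixPencil F K.Reg K.Reg :=
  (MatrixPencil.blockSum fun i => MatrixPencil.infBlock F (K.v i)).directSum
    ((MatrixPencil.blockSum fun i => MatrixPencil.jordanBlock (K.d i) (K.a i)).directSum
      ⟨K.Q, 1⟩)

/-- The whole canonical pencil `S(λ) ⊕ (A' + λ B')`. -/
def pencil : MatrixPencil F (K.SingRow ⊕ K.Reg) (K.SingCol ⊕ K.Reg) :=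
  K.singularPart.directSum K.regularPart

/-- The sum of all minimal indices. -/
def indexSum : ℕ := ∑ i, K.k i + ∑ i, K.l i

/-- The size of the regular part. -/
def regDim : ℕ := ∑ i, K.v i + ∑ i, K.d i + K.q

open Classical in
/-- The number of Jordan blocks whose elementary divisor is a power of `c + λ`. -/
noncomputable def count (c : F) : ℕ := (Finset.univ.filter fun i => K.a i = c).card

end KroneckerForm

/-- `K` is a Kronecker canonical form of the `m × n` pencil `L = A + λ B`: some
`(P, U) ∈ GL_m(F) × GL_n(F)` transforms `L` into `P A Uᵀ + λ P B Uᵀ`, which is the pencil of `K`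
(up to numbering the rows and columns of the latter by `1, …, m` and `1, …, n`). -/
def HasKroneckerForm {F : Type*} [Field F] {m n : ℕ}
    (L : MatrixPencil F (Fin m) (Fin n)) (K : KroneckerForm F) : Prop :=
  ∃ (eRow : K.SingRow ⊕ K.Reg ≃ Fin m) (eCol : K.SingCol ⊕ K.Reg ≃ Fin n)
    (P : GL (Fin m) F) (U : GL (Fin n) F),
    P.1 * L.const * U.1ᵀ = Matrix.reindex eRow eCol K.pencil.const ∧
    P.1 * L.lin * U.1ᵀ = Matrix.reindex eRow eCol K.pencil.lin

/-- The largest component of a triple. -/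
def firstLargest (x y z : ℕ) : ℕ := max x (max y z)

/-- The second largest component (with multiplicity) of a triple. -/
def secondLargest (x y z : ℕ) : ℕ := max (min x y) (max (min x z) (min y z))

/-! Rank is additive over direct sums and invariant under equivalence, so `t A + u B` with `(t, u) ≠
0` is evaluated block by block. Every `L_k` and `R_l` keeps full rank `k`, `l`, which accounts for
the constant `indexSum`. A block `N_v` loses exactly one rank when `t = 0`, a Jordan block with
eigenvalue `a` exactly one when `t a + u = 0`, and neither loses any otherwise. The `Q` block never
loses rank: if `Q + cE` were singular, `X - c` would not act surjectively on the cokernel of `Q +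
XE`, and the structure theorem over `F[X]` would yield an elementary divisor `(X - c)^e` with `e >
0`. The nullity of the regular part is thus a function on the projective line, equal to `j` at `(0 :
1)` and to `count a` at `(1 : -a)`. Its largest value gives `s`; its largest value away from a
maximizer gives `r`. Both occur in the triple `(j, k_s, k_r)`. -/

namespace Matrix

/-! ### Additivity of rank over block diagonal matrices, via kernels -/

theorem rank_add_finrank_ker_mulVecLin {F m n : Type*} [Field F] [Fintype n] (A : Matrix m n F) :
    A.rank + Module.finrank F (LinearMap.ker A.mulVecLin) = Fintype.card n := by
  rw [Matrix.rank, LinearMap.finrank_range_add_finrank_ker, Module.finrank_fintype_fun_eq_card]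

/-- The kernel of a block diagonal matrix is the product of the kernels of the blocks. -/
def kerFromBlocksEquiv {F m n m' n' : Type*} [Field F] [Fintype n] [Fintype n']
    (A : Matrix m n F) (D : Matrix m' n' F) :
    LinearMap.ker (fromBlocks A 0 0 D).mulVecLin ≃ₗ[F]
      LinearMap.ker A.mulVecLin × LinearMap.ker D.mulVecLin where
  toFun x := (⟨x.1 ∘ Sum.inl, by
      have h := x.2
      rw [LinearMap.mem_ker, mulVecLin_apply, fromBlocks_mulVec] at h
      simpa using congrArg (· ∘ Sum.inl) h⟩, ⟨x.1 ∘ Sum.inr, by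
      have h := x.2
      rw [LinearMap.mem_ker, mulVecLin_apply, fromBlocks_mulVec] at h
      simpa using congrArg (· ∘ Sum.inr) h⟩)
  map_add' _ _ := rfl
  map_smul' _ _ := rfl
  invFun y := ⟨Sum.elim y.1.1 y.2.1, by
      have h₁ : A *ᵥ y.1.1 = 0 := y.1.2
      have h₂ : D *ᵥ y.2.1 = 0 := y.2.2
      rw [LinearMap.mem_ker, mulVecLin_apply, fromBlocks_mulVec]
      ext (i | i) <;> simp [h₁, h₂]⟩
  left_inv x := by ext (i | i) <;> rfl
  right_inv _ := rfl

theorem rank_fromBlocks_diagonal {F m n m' n' : Type*} [Field F] [Fintype n] [Fintype n']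
    (A : Matrix m n F) (D : Matrix m' n' F) :
    (fromBlocks A 0 0 D).rank = A.rank + D.rank := by
  have h := rank_add_finrank_ker_mulVecLin (fromBlocks A 0 0 D)
  have h₁ := rank_add_finrank_ker_mulVecLin A
  have h₂ := rank_add_finrank_ker_mulVecLin D
  rw [(kerFromBlocksEquiv A D).finrank_eq, Module.finrank_prod, Fintype.card_sum] at h
  omega

theorem blockDiagonal'_mulVec_apply {F ι : Type*} [Field F] [Fintype ι] [DecidableEq ι]
    {m n : ι → Type*} [∀ i, Fintype (n i)] (A : ∀ i, Matrix (m i) (n i) F)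
    (x : (Σ i, n i) → F) (i : ι) (a : m i) :
    (blockDiagonal' A *ᵥ x) ⟨i, a⟩ = (A i *ᵥ fun b => x ⟨i, b⟩) a := by
  simp only [mulVec, dotProduct, Fintype.sum_sigma]
  rw [Finset.sum_eq_single i]
  · simp [blockDiagonal'_apply_eq]
  · intro k _ hk
    simp [blockDiagonal'_apply_ne A _ _ hk.symm]
  · simp

/-- The kernel of a block diagonal matrix is the product of the kernels of the blocks. -/
def kerBlockDiagonal'Equiv {F ι : Type*} [Field F] [Fintype ι] [DecidableEq ι]
    {m n : ι → Type*} [∀ i, Fintype (n i)] (A : ∀ i, Matrix (m i) (n i) F) :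
    LinearMap.ker (blockDiagonal' A).mulVecLin ≃ₗ[F] ∀ i, LinearMap.ker (A i).mulVecLin where
  toFun x i := ⟨fun b => x.1 ⟨i, b⟩, by
    ext a
    rw [mulVecLin_apply, ← blockDiagonal'_mulVec_apply]
    exact congrFun x.2 ⟨i, a⟩⟩
  map_add' _ _ := rfl
  map_smul' _ _ := rfl
  invFun y := ⟨fun b => (y b.1).1 b.2, by
    ext ⟨i, a⟩
    rw [mulVecLin_apply, blockDiagonal'_mulVec_apply]
    exact congrFun (y i).2 a⟩
  left_inv _ := rfl
  right_inv _ := rfl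

theorem rank_blockDiagonal' {F ι : Type*} [Field F] [Fintype ι] [DecidableEq ι]
    {m n : ι → Type*} [∀ i, Fintype (n i)] (A : ∀ i, Matrix (m i) (n i) F) :
    (blockDiagonal' A).rank = ∑ i, (A i).rank := by
  have h := rank_add_finrank_ker_mulVecLin (blockDiagonal' A)
  rw [(kerBlockDiagonal'Equiv A).finrank_eq, Module.finrank_pi_fintype, Fintype.card_sigma,
    ← Finset.sum_congr rfl fun i _ => rank_add_finrank_ker_mulVecLin (A i),
    Finset.sum_add_distrib] at h
  exact Nat.add_right_cancel h

end Matrix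

/-! ### Ranks of the singular blocks and of the shift -/

namespace MatrixPencil

variable {F : Type*} [Field F]

theorem rank_comb_directSum {m n m' n' : Type*} [Fintype n] [Fintype n']
    (L : MatrixPencil F m n) (M : MatrixPencil F m' n') (x : F × F) :
    ((L.directSum M).comb x).rank = (L.comb x).rank + (M.comb x).rank := by
  rw [← rank_fromBlocks_diagonal]
  simp [comb, directSum, fromBlocks_smul, fromBlocks_add]

theorem rank_comb_blockSum {p : ℕ} {m n : Fin p → Type*} [∀ i, Fintype (n i)]
    (L : ∀ i, MatrixPencil F (m i) (n i)) (x : F × F) :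
    ((blockSum L).comb x).rank = ∑ i, ((L i).comb x).rank := by
  rw [← rank_blockDiagonal']
  simp only [comb, blockSum, ← blockDiagonal'_smul, ← blockDiagonal'_add]
  rfl

theorem comb_transpose {m n : Type*} (L : MatrixPencil F m n) (x : F × F) :
    L.transpose.comb x = (L.comb x)ᵀ := by
  simp [comb, transpose]

/-- The number of rows bounds the rank above. For the lower bound, one column is deleted: the last
leaves `u E` when `t = 0`, the first leaves a lower triangular matrix with diagonal `t` when `t ≠
0`. -/
theorem rank_comb_colBlock (k : ℕ) {x : F × F} (hx : x ≠ 0) :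
    ((colBlock F k).comb x).rank = k := by
  refine le_antisymm (by simpa using ((colBlock F k).comb x).rank_le_card_height) ?_
  by_cases ht : x.1 = 0
  · have hu : x.2 ≠ 0 := fun hu => hx (Prod.ext ht hu)
    have h : ((colBlock F k).comb x).submatrix id Fin.castSucc = x.2 • 1 := by
      ext i j
      simp [comb, colBlock, ht, Matrix.one_apply, Fin.ext_iff, eq_comm]
    have hr := rank_submatrix_le ((colBlock F k).comb x) id Fin.castSucc
    rwa [h, rank_of_det_ne_zero (by simp [hu]), Fintype.card_fin] at hr
  · have h : (((colBlock F k).comb x).submatrix id Fin.succ).det = x.1 ^ k := by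
      rw [det_of_isLowerTriangular]
      · simp [comb, colBlock]
      · intro i j hij
        have : (i : ℕ) < j := hij
        simp [comb, colBlock, show (j : ℕ) ≠ i by omega, show (j : ℕ) + 1 ≠ i by omega]
    have hr := rank_submatrix_le ((colBlock F k).comb x) id Fin.succ
    rwa [rank_of_det_ne_zero (by rw [h]; exact pow_ne_zero _ ht), Fintype.card_fin] at hr

theorem rank_comb_rowBlock (l : ℕ) {x : F × F} (hx : x ≠ 0) :
    ((rowBlock F l).comb x).rank = l := by
  rw [rowBlock, comb_transpose, rank_transpose, rank_comb_colBlock l hx]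

theorem det_smul_one_add_smul_shift (v : ℕ) (b c : F) :
    (b • (1 : Matrix (Fin v) (Fin v) F) + c • shift F v).det = b ^ v := by
  rw [det_of_isUpperTriangular]
  · simp [shift]
  · intro i j hij
    have : (j : ℕ) < i := hij
    simp [shift, Fin.ext_iff, show (i : ℕ) ≠ j by omega,
      show (j : ℕ) ≠ i + 1 by omega]

/-- Deleting the last row and the first column leaves `c E`, and the last row is zero. -/
theorem rank_smul_shift {v : ℕ} (hv : 0 < v) {c : F} (hc : c ≠ 0) :
    (c • shift F v).rank + 1 = v := by
  obtain ⟨v, rfl⟩ : ∃ w, v = w + 1 := ⟨v - 1, by omega⟩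
  have h : (c • shift F (v + 1)).submatrix Fin.castSucc Fin.succ = c • 1 := by
    ext i j
    simp [shift, Matrix.one_apply, Fin.ext_iff, eq_comm]
  have hr := rank_submatrix_le (c • shift F (v + 1)) Fin.castSucc Fin.succ
  rw [h, rank_of_det_ne_zero (by simp [hc]), Fintype.card_fin] at hr
  have hle : (c • shift F (v + 1)).rank ≤ v := by
    refine (rank_le_card_of_support_subset _ (Finset.univ.erase (Fin.last v)) ?_).trans
      (by simp)
    rw [Function.support_subset_iff']
    intro i hi
    obtain rfl : i = Fin.last v := by simpa using hi
    ext j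
    simp [shift, j.isLt.ne]
  omega

end MatrixPencil

/-! ### Primary summands of torsion modules over a principal ideal domain -/

theorem Module.exists_isCompl_of_equiv_directSum {R M ι : Type*} [CommRing R] [AddCommGroup M]
    [Module R M] {N : ι → Type*} [∀ i, AddCommGroup (N i)] [∀ i, Module R (N i)]
    (e : M ≃ₗ[R] DirectSum ι N) (i : ι) :
    ∃ P P' : Submodule R M, IsCompl P P' ∧ Nonempty (P ≃ₗ[R] N i) := by
  classical
  have hinv : (DirectSum.component R ι N i ∘ₗ e.toLinearMap) ∘ₗ
      (e.symm.toLinearMap ∘ₗ DirectSum.lof R ι N i) = LinearMap.id := by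
    ext x
    simp [DirectSum.component.lof_self]
  have hinv' := fun x => LinearMap.congr_fun hinv x
  set g := e.symm.toLinearMap ∘ₗ DirectSum.lof R ι N i
  set f := DirectSum.component R ι N i ∘ₗ e.toLinearMap
  have hc : IsCompl (LinearMap.range g) (LinearMap.ker f) := by
    constructor
    · rw [Submodule.disjoint_def]
      rintro _ ⟨x, rfl⟩ hx
      rw [show x = 0 from (hinv' x).symm.trans hx, map_zero]
    · rw [codisjoint_iff, eq_top_iff]
      intro x _
      refine Submodule.mem_sup.2 ⟨g (f x), ⟨_, rfl⟩, x - g (f x), ?_, add_sub_cancel _ _⟩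
      rw [LinearMap.mem_ker, map_sub, sub_eq_zero]
      exact (hinv' (f x)).symm
  refine ⟨_, _, hc, ⟨(LinearEquiv.ofInjective _ ?_).symm⟩⟩
  exact LinearMap.injective_of_comp_eq_id _ _ hinv

/-- In the primary decomposition, `g` acts surjectively on every summand whose prime power is
coprime to `g`. Failure of surjectivity therefore exposes a summand whose prime is associated to
`g`. -/
theorem Module.exists_prime_power_summand {R M : Type*} [CommRing R] [IsDomain R]
    [IsPrincipalIdealRing R] [AddCommGroup M] [Module R M] [Module.Finite R M]
    (hM : Module.IsTorsion R M) {g : R} (hg : Irreducible g)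
    (hsurj : ¬ Function.Surjective fun x : M => g • x) :
    ∃ e : ℕ, 0 < e ∧ ∃ P P' : Submodule R M,
      IsCompl P P' ∧ Nonempty (P ≃ₗ[R] (R ⧸ Ideal.span {g ^ e})) := by
  classical
  obtain ⟨ι, _, p, hp, e, ⟨φ⟩⟩ := Module.equiv_directSum_of_isTorsion hM
  by_cases h : ∃ i, ¬ IsCoprime g (p i ^ e i)
  · obtain ⟨i, hi⟩ := h
    have he : 0 < e i := by
      rcases Nat.eq_zero_or_pos (e i) with h0 | h0
      · exact absurd (by rw [h0, pow_zero]; exact isCoprime_one_right) hi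
      · exact h0
    have hgp : Associated (p i) g := by
      by_contra hna
      refine hi (IsCoprime.pow_right ?_)
      rw [hg.coprime_iff_not_dvd]
      exact fun hd => hna ((hg.dvd_irreducible_iff_associated (hp i)).1 hd).symm
    obtain ⟨P, P', hc, ⟨ψ⟩⟩ := Module.exists_isCompl_of_equiv_directSum φ i
    exact ⟨e i, he, P, P', hc, ⟨ψ.trans (Submodule.quotEquivOfEq _ _
      (Ideal.span_singleton_eq_span_singleton.2 (hgp.pow_pow)))⟩⟩
  · push Not at h
    refine absurd ?_ hsurj
    -- If `a g + b p^e = 1`, then `a y` is a preimage of `y` under `g` modulo `p^e`.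
    have key : ∀ i, ∀ y : R ⧸ R ∙ p i ^ e i, ∃ z, g • z = y := by
      intro i y
      obtain ⟨a, b, hab⟩ := h i
      obtain ⟨y, rfl⟩ := Submodule.Quotient.mk_surjective _ y
      refine ⟨Submodule.Quotient.mk (a * y), ?_⟩
      rw [← Submodule.Quotient.mk_smul, Submodule.Quotient.eq, Submodule.mem_span_singleton]
      refine ⟨-(b * y), ?_⟩
      simp only [smul_eq_mul]
      linear_combination (-y) * hab
    choose z hz using key
    intro x
    refine ⟨φ.symm (DFinsupp.equivFunOnFintype.symm fun i => z i (φ x i)), ?_⟩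
    apply φ.injective
    simp only [map_smul, LinearEquiv.apply_symm_apply]
    refine DFinsupp.ext fun i => ?_
    exact hz i _

/-! ### Nonsingularity of `Q + cE` -/

section

variable {F : Type*} [Field F] {q : ℕ} (Q : Matrix (Fin q) (Fin q) F)

theorem MatrixPencil.toPolyMatrix_one_eq_charmatrix :
    (MatrixPencil.mk Q 1).toPolyMatrix = (-Q).charmatrix := by
  ext i j : 2
  by_cases h : i = j <;> simp [toPolyMatrix, charmatrix, h, add_comm]

/-- By the adjugate identity, `M.det` annihilates the cokernel. -/
theorem Matrix.isTorsion_quotient_range {R : Type*} [CommRing R] [IsDomain R]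
    {n : Type*} [Fintype n] [DecidableEq n] {M : Matrix n n R} (hM : M.det ≠ 0) :
    Module.IsTorsion R ((n → R) ⧸ LinearMap.range M.mulVecLin) := by
  intro x
  obtain ⟨x, rfl⟩ := Submodule.Quotient.mk_surjective _ x
  refine ⟨⟨M.det, mem_nonZeroDivisors_of_ne_zero hM⟩, ?_⟩
  change M.det • (Submodule.Quotient.mk x : (n → R) ⧸ LinearMap.range M.mulVecLin) = 0
  rw [← Submodule.Quotient.mk_smul, Submodule.Quotient.mk_eq_zero]
  refine ⟨M.adjugate *ᵥ x, ?_⟩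
  rw [mulVecLin_apply, mulVec_mulVec, mul_adjugate, smul_mulVec, one_mulVec]

/-- If `X - C c` acts surjectively on the cokernel of `Q + X`, then `Q + c` is invertible. -/
theorem MatrixPencil.det_ne_zero_of_surjective (c : F)
    (h : Function.Surjective fun x : (Fin q → F[X]) ⧸
      LinearMap.range (MatrixPencil.mk Q 1).toPolyMatrix.mulVecLin => (C (-c) + X) • x) :
    (Q + c • (1 : Matrix (Fin q) (Fin q) F)).det ≠ 0 := by
  refine ((mulVec_surjective_iff_isUnit (A := Q + c • 1)).1 fun w => ?_) |>.map
    detMonoidHom |>.ne_zero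
  obtain ⟨x, hx⟩ := h (Submodule.Quotient.mk fun i => C (w i))
  obtain ⟨x, rfl⟩ := Submodule.Quotient.mk_surjective _ x
  simp only [← Submodule.Quotient.mk_smul] at hx
  rw [Submodule.Quotient.eq] at hx
  obtain ⟨y, hy⟩ := hx
  -- Here `(Q + X) y = (X - c) x - w`; evaluating at `c` removes `x` and leaves `(Q + c) y(c) = -w`.
  refine ⟨fun i => - (y i).eval c, funext fun i => ?_⟩
  have h := congrArg (eval c) (congrFun hy i)
  have h' : ∑ k, Q i k * (y k).eval c + c * (y i).eval c = -w i := by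
    simpa [toPolyMatrix, mulVec, dotProduct, eval_finsetSum, add_mul, Matrix.one_apply,
      Finset.sum_add_distrib] using h
  have hw : (∑ k, Q i k * -(y k).eval c) + c * -(y i).eval c = w i := by
    simp only [mul_neg, Finset.sum_neg_distrib]
    linear_combination -h'
  rw [add_mulVec, smul_mulVec, one_mulVec]
  exact hw

theorem det_add_smul_one_ne_zero
    (hQ : ∀ f : F[X], IsElementaryDivisor (MatrixPencil.mk Q 1).toPolyMatrix f →
      ¬ ∃ (b : F) (e : ℕ), f = (C b + X) ^ e) (c : F) :
    (Q + c • (1 : Matrix (Fin q) (Fin q) F)).det ≠ 0 := by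
  refine MatrixPencil.det_ne_zero_of_surjective Q c ?_
  by_contra h
  have hmonic : (C (-c) + X : F[X]).Monic := by rw [add_comm]; exact monic_X_add_C _
  have hirr : Irreducible (C (-c) + X : F[X]) := by
    rw [add_comm, C_neg, ← sub_eq_add_neg]; exact irreducible_X_sub_C c
  -- The determinant is the characteristic polynomial of `-Q`, hence monic and nonzero.
  have htors := Matrix.isTorsion_quotient_range (M := (MatrixPencil.mk Q 1).toPolyMatrix) (by
    rw [MatrixPencil.toPolyMatrix_one_eq_charmatrix]
    exact ((-Q).charpoly_monic).ne_zero)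
  obtain ⟨e, he, P, P', hc, hP⟩ := Module.exists_prime_power_summand htors hirr h
  exact hQ _ ⟨⟨_, e, hmonic, hirr, he, rfl⟩, P, P', hc, hP⟩ ⟨_, e, rfl⟩

end

/-! ### Ranks of the regular blocks -/

namespace MatrixPencil

variable {F : Type*} [Field F]

theorem rank_comb_infBlock_of_ne_zero (v : ℕ) {x : F × F} (hx : x.1 ≠ 0) :
    ((infBlock F v).comb x).rank = v := by
  rw [rank_of_det_ne_zero, Fintype.card_fin]
  change (x.1 • (1 : Matrix (Fin v) (Fin v) F) + x.2 • shift F v).det ≠ 0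
  rw [det_smul_one_add_smul_shift]
  exact pow_ne_zero _ hx

theorem rank_comb_infBlock_of_eq_zero {v : ℕ} (hv : 0 < v) {x : F × F} (hx : x.1 = 0)
    (hx' : x.2 ≠ 0) : ((infBlock F v).comb x).rank + 1 = v := by
  simpa [comb, infBlock, hx] using rank_smul_shift hv hx'

theorem comb_jordanBlock (d : ℕ) (a : F) (x : F × F) :
    (jordanBlock d a).comb x =
      (x.1 * a + x.2) • (1 : Matrix (Fin d) (Fin d) F) + x.1 • shift F d := by
  simp only [comb, jordanBlock]
  module

theorem rank_comb_jordanBlock_of_ne_zero (d : ℕ) (a : F) {x : F × F} (hx : x.1 * a + x.2 ≠ 0) :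
    ((jordanBlock d a).comb x).rank = d := by
  rw [rank_of_det_ne_zero, Fintype.card_fin]
  rw [comb_jordanBlock, det_smul_one_add_smul_shift]
  exact pow_ne_zero _ hx

theorem rank_comb_jordanBlock_of_eq_zero {d : ℕ} (hd : 0 < d) (a : F) {x : F × F}
    (hx : x.1 * a + x.2 = 0) (hx' : x.1 ≠ 0) : ((jordanBlock d a).comb x).rank + 1 = d := by
  rw [comb_jordanBlock, hx, zero_smul, zero_add, rank_smul_shift hd hx']

end MatrixPencil

/-! ### The nullity function of the regular part -/

namespace KroneckerForm

variable {F : Type*} [Field F] (K : KroneckerForm F)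

open Classical in
/-- The nullity of `t A' + u B'`, where `x = (t, u)` is nonzero. -/
noncomputable def nullity (x : F × F) : ℕ :=
  if x.1 = 0 then K.j else K.count (-(x.2 / x.1))

theorem rank_comb_Q {x : F × F} (hx : x ≠ 0) :
    ((MatrixPencil.mk K.Q 1).comb x).rank = K.q := by
  rw [rank_of_det_ne_zero, Fintype.card_fin]
  by_cases ht : x.1 = 0
  · have hu : x.2 ≠ 0 := fun hu => hx (Prod.ext ht hu)
    simp [MatrixPencil.comb, ht, hu]
  · have h : (MatrixPencil.mk K.Q 1).comb x =
        x.1 • (K.Q + (x.2 / x.1) • (1 : Matrix (Fin K.q) (Fin K.q) F)) := by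
      rw [smul_add, smul_smul, mul_div_cancel₀ _ ht]
      rfl
    rw [h, det_smul]
    exact mul_ne_zero (pow_ne_zero _ ht) (det_add_smul_one_ne_zero K.Q K.Q_nonlinear _)

open Classical in
theorem rank_comb_infBlocks {x : F × F} (hx : x ≠ 0) :
    ((MatrixPencil.blockSum fun i => MatrixPencil.infBlock F (K.v i)).comb x).rank +
      (if x.1 = 0 then K.j else 0) = ∑ i, K.v i := by
  rw [MatrixPencil.rank_comb_blockSum]
  split_ifs with ht
  · have hu : x.2 ≠ 0 := fun hu => hx (Prod.ext ht hu)
    simp [← fun i => MatrixPencil.rank_comb_infBlock_of_eq_zero (K.v_pos i) ht hu,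
      Finset.sum_add_distrib]
  · simp [MatrixPencil.rank_comb_infBlock_of_ne_zero _ ht]

open Classical in
theorem rank_comb_jordanBlocks {x : F × F} (hx : x ≠ 0) :
    ((MatrixPencil.blockSum fun i => MatrixPencil.jordanBlock (K.d i) (K.a i)).comb x).rank +
      (if x.1 = 0 then 0 else K.count (-(x.2 / x.1))) = ∑ i, K.d i := by
  rw [MatrixPencil.rank_comb_blockSum]
  split_ifs with ht
  · have hu : x.2 ≠ 0 := fun hu => hx (Prod.ext ht hu)
    rw [add_zero]
    exact Finset.sum_congr rfl fun i _ =>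
      MatrixPencil.rank_comb_jordanBlock_of_ne_zero _ _ (by simpa [ht] using hu)
  · rw [count, Finset.card_filter, ← Finset.sum_add_distrib]
    refine Finset.sum_congr rfl fun i _ => ?_
    have hi : K.a i = -(x.2 / x.1) ↔ x.1 * K.a i + x.2 = 0 := by
      rw [← neg_div, eq_div_iff ht, mul_comm, eq_neg_iff_add_eq_zero]
    split_ifs with h
    · exact MatrixPencil.rank_comb_jordanBlock_of_eq_zero (K.d_pos i) _ (hi.1 h) ht
    · exact MatrixPencil.rank_comb_jordanBlock_of_ne_zero _ _ fun h' => h (hi.2 h')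

theorem rank_comb_regularPart {x : F × F} (hx : x ≠ 0) :
    (K.regularPart.comb x).rank + K.nullity x = K.regDim := by
  have h₁ := K.rank_comb_infBlocks hx
  have h₂ := K.rank_comb_jordanBlocks hx
  rw [regularPart, MatrixPencil.rank_comb_directSum, MatrixPencil.rank_comb_directSum,
    K.rank_comb_Q hx, regDim, nullity]
  split_ifs at * <;> omega

theorem rank_comb_singularPart {x : F × F} (hx : x ≠ 0) :
    (K.singularPart.comb x).rank = K.indexSum := by
  simp only [singularPart, MatrixPencil.rank_comb_directSum, MatrixPencil.rank_comb_blockSum,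
    MatrixPencil.rank_comb_colBlock _ hx, MatrixPencil.rank_comb_rowBlock _ hx, indexSum]

theorem rank_comb_of_hasKroneckerForm {m n : ℕ} {L : MatrixPencil F (Fin m) (Fin n)}
    (hK : HasKroneckerForm L K) (x : F × F) : (L.comb x).rank = (K.pencil.comb x).rank := by
  obtain ⟨eRow, eCol, P, U, hA, hB⟩ := hK
  have h : P.1 * L.comb x * U.1ᵀ = reindex eRow eCol (K.pencil.comb x) := by
    simp only [MatrixPencil.comb, Matrix.mul_add, Matrix.add_mul, Matrix.mul_smul,
      Matrix.smul_mul, hA, hB]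
    rfl
  rw [← rank_reindex eRow eCol (K.pencil.comb x), ← h, rank_mul_eq_left_of_isUnit_det,
    rank_mul_eq_right_of_isUnit_det]
  · exact (isUnit_iff_isUnit_det _).1 P.isUnit
  · rw [det_transpose]
    exact (isUnit_iff_isUnit_det _).1 U.isUnit

theorem rank_comb_add_nullity {m n : ℕ} {L : MatrixPencil F (Fin m) (Fin n)}
    (hK : HasKroneckerForm L K) {x : F × F} (hx : x ≠ 0) :
    (L.comb x).rank + K.nullity x = K.regDim + K.indexSum := by
  rw [K.rank_comb_of_hasKroneckerForm hK, pencil, MatrixPencil.rank_comb_directSum,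
    K.rank_comb_singularPart hx, ← K.rank_comb_regularPart hx]
  ring

/-! ### Minimal ranks as the two largest nullities -/

theorem mem_span_singleton_iff_of_fst_ne_zero {x y : F × F} (hx : x.1 ≠ 0) :
    y ∈ Submodule.span F {x} ↔ y.2 * x.1 = x.2 * y.1 := by
  rw [Submodule.mem_span_singleton]
  constructor
  · rintro ⟨c, rfl⟩
    simp only [Prod.smul_fst, Prod.smul_snd, smul_eq_mul]
    ring
  · intro h
    refine ⟨y.1 / x.1, Prod.ext ?_ ?_⟩
    · simp [hx]
    · simp only [Prod.smul_snd, smul_eq_mul]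
      field_simp
      linear_combination -h

theorem mem_span_singleton_of_fst_eq_zero {x y : F × F} (hx : x ≠ 0) (h : x.1 = 0)
    (hy : y.1 = 0) : y ∈ Submodule.span F {x} := by
  have hu : x.2 ≠ 0 := fun hu => hx (Prod.ext h hu)
  exact Submodule.mem_span_singleton.2 ⟨y.2 / x.2, Prod.ext (by simp [h, hy]) (by simp [hu])⟩

/-- Only the relation rank + nullity = `N` matters, so the same argument serves the regular part and
the whole pencil, with different `N`. -/
theorem hasMinRanks_of_rank_add_nullity {m n : Type*} [Fintype n] {L : MatrixPencil F m n}
    {N r s : ℕ} (hL : ∀ x : F × F, x ≠ 0 → (L.comb x).rank + K.nullity x = N)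
    {a₁ a₂ : F} (ha₁ : ∀ c : F, K.count c ≤ K.count a₁) (ha₂ : a₂ ≠ a₁)
    (ha₂' : ∀ c : F, c ≠ a₁ → K.count c ≤ K.count a₂)
    (hr : r + secondLargest K.j (K.count a₁) (K.count a₂) = N)
    (hs : s + firstLargest K.j (K.count a₁) (K.count a₂) = N) : L.HasMinRanks r s := by
  have h21 := ha₁ a₂
  have hinf : K.nullity (0, 1) = K.j := by simp [nullity]
  have hfin (c : F) : K.nullity (1, -c) = K.count c := by simp [nullity]
  have hinf0 : ((0, 1) : F × F) ≠ 0 := by simp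
  have hfin0 (c : F) : ((1, -c) : F × F) ≠ 0 := by simp
  have hLinf := hL _ hinf0
  rw [hinf] at hLinf
  have hLfin (c : F) : (L.comb (1, -c)).rank + K.count c = N := by
    rw [← hfin c, hL _ (hfin0 c)]
  have hL₁ := hLfin a₁
  have hL₂ := hLfin a₂
  have hspan {y x : F × F} (hy : y ∉ Submodule.span F {x}) : y ≠ 0 :=
    fun h => hy (h ▸ Submodule.zero_mem _)
  unfold firstLargest at hs
  unfold secondLargest at hr
  refine ⟨⟨?_, ?_⟩, ?_⟩
  · rcases le_total K.j (K.count a₁) with h | h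
    · exact ⟨(1, -a₁), hfin0 _, by omega⟩
    · exact ⟨(0, 1), hinf0, by omega⟩
  · rintro _ ⟨x, hx, rfl⟩
    have h := hL x hx
    unfold nullity at h
    have := ha₁ (-(x.2 / x.1))
    split_ifs at h <;> omega
  · rintro x ⟨hx, hmin⟩
    have hxN := hL x hx
    have hmininf := hmin _ hinf0
    have hmin₁ := hmin _ (hfin0 a₁)
    -- A minimizer at infinity forces `j` to be the largest nullity, so the runner-up is `count a₁`.
    by_cases ht : x.1 = 0
    · rw [nullity, if_pos ht] at hxN
      refine ⟨⟨(1, -a₁), fun h => ?_, by omega⟩, ?_⟩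
      · obtain ⟨c, hc⟩ := Submodule.mem_span_singleton.1 h
        simpa [ht] using congrArg Prod.fst hc
      · rintro _ ⟨y, hy, rfl⟩
        have hyN := hL y (hspan hy)
        rw [nullity, if_neg fun h => hy (mem_span_singleton_of_fst_eq_zero hx ht h)] at hyN
        have := ha₁ (-(y.2 / y.1))
        omega
    · rw [nullity, if_neg ht] at hxN
      obtain ⟨c, hc⟩ : ∃ c, c = -(x.2 / x.1) := ⟨_, rfl⟩
      rw [← hc] at hxN
      have hxc : x.2 = -c * x.1 := by rw [hc]; field_simp
      have hc₁ := ha₁ c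
      constructor
      · by_cases hca : c = a₁
        · rcases le_total K.j (K.count a₂) with h | h
          · refine ⟨(1, -a₂), fun h => ?_, by omega⟩
            rw [mem_span_singleton_iff_of_fst_ne_zero ht, hxc, hca] at h
            exact ha₂ (mul_right_cancel₀ ht (by linear_combination -h))
          · refine ⟨(0, 1), fun h => ?_, by rw [hca] at hxN; omega⟩
            rw [mem_span_singleton_iff_of_fst_ne_zero ht] at h
            exact ht (by simpa using h)
        -- Minimality at `c ≠ a₁` forces the tie `count c = count a₂ = count a₁ ≥ j`, so `a₁`
        -- attains the second largest value.
        · have := ha₂' c hca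
          refine ⟨(1, -a₁), fun h => ?_, by omega⟩
          rw [mem_span_singleton_iff_of_fst_ne_zero ht, hxc] at h
          exact hca (mul_right_cancel₀ ht (by linear_combination h))
      · rintro _ ⟨y, hy, rfl⟩
        have hyN := hL y (hspan hy)
        unfold nullity at hyN
        split_ifs at hyN with hy0
        -- Since `c` is a minimizer, `j ≤ count c ≤ count a₁`, so `j` does not exceed the second
        -- largest value.
        · omega
        · have hne : -(y.2 / y.1) ≠ c := by
            intro h
            apply hy
            rw [mem_span_singleton_iff_of_fst_ne_zero ht, hxc, ← h]
            field_simp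
          obtain ⟨b, hb⟩ : ∃ b, b = -(y.2 / y.1) := ⟨_, rfl⟩
          rw [← hb] at hyN hne
          -- If `b = a₁`, then `c ≠ a₁` and the same tie bounds `count b`; otherwise `count b ≤
          -- count a₂` suffices.
          by_cases hya : b = a₁
          · have := ha₂' c fun h => hne (hya.trans h.symm)
            rw [hya] at hyN
            omega
          · have := ha₂' b hya
            clear hs hmininf hmin₁ hLinf hL₁ hL₂ hxN hc₁
            omega

end KroneckerForm

theorem mainTheorem4 {F : Type*} [Field F] {m n : ℕ} (A B : Matrix (Fin m) (Fin n) F)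
    (K : KroneckerForm F) (hK : HasKroneckerForm (MatrixPencil.mk A B) K)
    -- `k_s = count a₁` is the largest number of Jordan blocks sharing a factor `a₁ + λ`
    (a₁ : F) (ha₁ : ∀ c : F, K.count c ≤ K.count a₁)
    -- `k_r = count a₂` is the second largest one, with `a₂ ≠ a₁`
    (a₂ : F) (ha₂ : a₂ ≠ a₁) (ha₂' : ∀ c : F, c ≠ a₁ → K.count c ≤ K.count a₂) :
    ∃ r' s' : ℕ,
      r' + secondLargest K.j (K.count a₁) (K.count a₂) = K.regDim ∧
      s' + firstLargest K.j (K.count a₁) (K.count a₂) = K.regDim ∧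
      K.regularPart.HasMinRanks r' s' ∧
      (MatrixPencil.mk A B).HasMinRanks (r' + K.indexSum) (s' + K.indexSum) := by
  -- Nullities are at most `regDim`, so the subtractions defining `r` and `s` below are not
  -- truncated.
  have hj : K.j ≤ K.regDim := by
    rw [← K.rank_comb_regularPart (x := (0, 1)) (by simp)]
    simp [KroneckerForm.nullity]
  have hcount (c : F) : K.count c ≤ K.regDim := by
    rw [← K.rank_comb_regularPart (x := (1, -c)) (by simp)]
    simp [KroneckerForm.nullity]
  have h₁ := hcount a₁
  have h₂ := hcount a₂
  obtain ⟨r, hr⟩ : ∃ r, r + secondLargest K.j (K.count a₁) (K.count a₂) = K.regDim :=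
    ⟨_, Nat.sub_add_cancel (by unfold secondLargest; omega)⟩
  obtain ⟨s, hs⟩ : ∃ s, s + firstLargest K.j (K.count a₁) (K.count a₂) = K.regDim :=
    ⟨_, Nat.sub_add_cancel (by unfold firstLargest; omega)⟩
  exact ⟨r, s, hr, hs,
    K.hasMinRanks_of_rank_add_nullity (fun _ => K.rank_comb_regularPart) ha₁ ha₂ ha₂' hr hs,
    K.hasMinRanks_of_rank_add_nullity (fun _ => K.rank_comb_add_nullity hK) ha₁ ha₂ ha₂'
      (by omega) (by omega)⟩
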